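/- Let $X_1,X_2,\dots$ be i.i.d. normal random variables with mean $0$ and variance $\sigma^2>0$, and put $S_n=\sum_{i=1}^n X_i$, $V_n=\big(\sum_{i=1}^n X_i^2\big)^{1/2}$. Let $\Phi$ be the standard normal distribution function. (i) For every real sequence $(x_n)$ with $x_n\to\infty$ and $x_n=o(n^{1/2})$, as $n\to\infty$, $$\frac{P(S_n/V_n>x_n)}{1-\Phi(x_n)}=\exp\Big(-\frac{x_n^4}{4n}(1+o(1))\Big)(1+o(1)),\qquad \frac{P(S_n/V_n<-x_n)}{\Phi(-x_n)}=\exp\Big(-\frac{x_n^4}{4n}(1+o(1))\Big)(1+o(1)).$$ (ii) For every real sequence $(x_n)$ with $x_n\ge 0$ for all large $n$ (in particular for every sequence as in (i)), $\dfrac{P(S_n/V_n>x_n)}{1-\Phi(x_n)}\to 1$ if and only if $x_n=o(n^{1/4})$, and likewise $\dfrac{P(S_n/V_n<-x_n)}{\Phi(-x_n)}\to 1$ if and only if $x_n=o(n^{1/4})$. -/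

import Mathlib

open MeasureTheory ProbabilityTheory Filter Topology Asymptotics
open scoped NNReal

/-- The partial sum `S_n = X_1 + ⋯ + X_n` (the variables are indexed from `0`). -/
def partialSum {Ω : Type*} (X : ℕ → Ω → ℝ) (n : ℕ) (ω : Ω) : ℝ :=
  ∑ i ∈ Finset.range n, X i ω

/-- The self-normalizer `V_n = (X_1² + ⋯ + X_n²)^{1/2}`. -/
noncomputable def selfNormalizer {Ω : Type*} (X : ℕ → Ω → ℝ) (n : ℕ) (ω : Ω) : ℝ :=
  Real.sqrt (∑ i ∈ Finset.range n, X i ω ^ 2)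

/-- The distribution function `Φ` of the standard normal law. -/
noncomputable def stdNormalCDF (x : ℝ) : ℝ := cdf (gaussianReal 0 1) x

/-- `P(S_n / V_n > x) / (1 - Φ(x))`. -/
noncomputable def upperTailRatio {Ω : Type*} [MeasurableSpace Ω] (P : Measure Ω)
    (X : ℕ → Ω → ℝ) (n : ℕ) (x : ℝ) : ℝ :=
  P.real {ω | partialSum X n ω / selfNormalizer X n ω > x} / (1 - stdNormalCDF x)

/-- `P(S_n / V_n < -x) / Φ(-x)`. -/
noncomputable def lowerTailRatio {Ω : Type*} [MeasurableSpace Ω] (P : Measure Ω)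
    (X : ℕ → Ω → ℝ) (n : ℕ) (x : ℝ) : ℝ :=
  P.real {ω | partialSum X n ω / selfNormalizer X n ω < -x} / stdNormalCDF (-x)

/-! Scale to σ = 1. Then Z = S/√n is standard normal and independent of the sum W of squared
deviations from the mean, and V² = Z² + W. So for 0 ≤ x < √n the event S/V > x reads Z > a√W with a²
= x²/(n − x²). Craig's formula has the squared level in an exponent, so averaging over W gives the
exact tail as an integral of the mgf of W (`measureReal_lt_sum_div_sqrt_sum_sq`).

The substitution t = xu extracts (1 − x²/n)^((n−1)/2) from this tail and exp(−x²/2) from the normal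
one. The two remaining integrals have ratio tending to 1, uniformly in x ≥ 1
(`tendsto_selfNormalizedMills_div_normalMills`). With y = x²/n, the quotient of leading factors is
exp((n/2)(log(1 − y) + y)) · (1 − y)^(−1/2), and log(1 − y) + y ~ −y²/2 yields −x⁴/(4n).

For (ii), the range 0 ≤ x ≤ 1 is treated separately: there the ratio always tends to 1. For x ≥ 1,
sufficiency is the expansion; necessity uses log(1 − y) ≤ −y − y²/2, which does not presuppose y →
0. -/

/-! ### Gaussian integrals and Craig's formula -/

theorem hasDerivAt_exp_neg_sq_mul {b : ℝ} (hb : 0 < b) (t : ℝ) :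
    HasDerivAt (fun t => -(Real.exp (-(t ^ 2 * b / 2)) / b))
      (t * Real.exp (-(t ^ 2 * b / 2))) t := by
  have h := ((((hasDerivAt_pow 2 t).mul_const b).div_const 2).neg.exp.div_const b).neg
  refine h.congr_deriv ?_
  simp only [Pi.neg_apply]
  field_simp
  norm_num
  ring

theorem tendsto_exp_neg_sq_mul {b : ℝ} (hb : 0 < b) :
    Tendsto (fun t : ℝ => -(Real.exp (-(t ^ 2 * b / 2)) / b)) atTop (𝓝 0) := by
  have h : Tendsto (fun t : ℝ => t ^ 2 * b / 2) atTop atTop :=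
    ((tendsto_pow_atTop two_ne_zero).atTop_mul_const hb).atTop_div_const two_pos
  simpa using ((Real.tendsto_exp_neg_atTop_nhds_zero.comp h).div_const b).neg

theorem integrableOn_Ioi_mul_exp_neg_sq_mul {b : ℝ} (hb : 0 < b) {y : ℝ} (hy : 0 ≤ y) :
    IntegrableOn (fun t => t * Real.exp (-(t ^ 2 * b / 2))) (Set.Ioi y) :=
  integrableOn_Ioi_deriv_of_nonneg' (fun t _ => hasDerivAt_exp_neg_sq_mul hb t)
    (fun _ ht => mul_nonneg (hy.trans (le_of_lt ht)) (Real.exp_nonneg _))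
    (tendsto_exp_neg_sq_mul hb)

theorem integral_Ioi_mul_exp_neg_sq_mul {b : ℝ} (hb : 0 < b) {y : ℝ} (hy : 0 ≤ y) :
    ∫ t in Set.Ioi y, t * Real.exp (-(t ^ 2 * b / 2)) = Real.exp (-(y ^ 2 * b / 2)) / b := by
  rw [integral_Ioi_of_hasDerivAt_of_nonneg' (fun t _ => hasDerivAt_exp_neg_sq_mul hb t)
    (fun _ ht => mul_nonneg (hy.trans (le_of_lt ht)) (Real.exp_nonneg _))
    (tendsto_exp_neg_sq_mul hb)]
  ring

theorem integral_Ioi_zero_mul_exp_neg_sq_mul {t : ℝ} (ht : 0 < t) :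
    ∫ u in Set.Ioi (0 : ℝ), t * Real.exp (-(t ^ 2 * (1 + u ^ 2) / 2)) =
      √(2 * Real.pi) / 2 * Real.exp (-t ^ 2 / 2) := by
  have h : ∀ u : ℝ, t * Real.exp (-(t ^ 2 * (1 + u ^ 2) / 2)) =
      (t * Real.exp (-t ^ 2 / 2)) * Real.exp (-(t ^ 2 / 2) * u ^ 2) := by
    intro u
    rw [mul_assoc, ← Real.exp_add]
    congr 2
    ring
  simp_rw [h]
  rw [integral_const_mul, integral_gaussian_Ioi,
    show Real.pi / (t ^ 2 / 2) = (2 * Real.pi) / t ^ 2 by field_simp,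
    Real.sqrt_div (by positivity), Real.sqrt_sq ht.le]
  field_simp

theorem integrable_exp_neg_div_one_add_sq {y : ℝ} :
    Integrable (fun u : ℝ => Real.exp (-(y ^ 2 * (1 + u ^ 2) / 2)) / (1 + u ^ 2)) := by
  refine integrable_inv_one_add_sq.mono'
    (Measurable.aestronglyMeasurable (by fun_prop)) (ae_of_all _ fun u => ?_)
  rw [Real.norm_of_nonneg (by positivity), div_eq_mul_inv]
  refine mul_le_of_le_one_left (by positivity) (Real.exp_le_one_iff.2 ?_)
  have : 0 ≤ y ^ 2 * (1 + u ^ 2) / 2 := by positivity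
  linarith

/-- Craig's formula for the Gaussian tail. -/
theorem gaussianReal_Ioi_eq_integral {y : ℝ} (hy : 0 ≤ y) :
    (gaussianReal 0 1).real (Set.Ioi y) =
      Real.pi⁻¹ * ∫ u in Set.Ioi (0 : ℝ), Real.exp (-(y ^ 2 * (1 + u ^ 2) / 2)) / (1 + u ^ 2) := by
  -- Fubini on u > 0, t > y: integrating in t first gives the Craig integrand, in u first a multiple
  -- of the normal density.
  have hint : Integrable (Function.uncurry fun u t : ℝ => t * Real.exp (-(t ^ 2 * (1 + u ^ 2) / 2)))
      ((volume.restrict (Set.Ioi 0)).prod (volume.restrict (Set.Ioi y))) := by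
    rw [integrable_prod_iff (by fun_prop)]
    refine ⟨ae_of_all _ fun u =>
      integrableOn_Ioi_mul_exp_neg_sq_mul (b := 1 + u ^ 2) (by positivity) hy, ?_⟩
    refine (integrable_exp_neg_div_one_add_sq (y := y)).integrableOn.congr (ae_of_all _ fun u => ?_)
    dsimp only
    rw [← integral_Ioi_mul_exp_neg_sq_mul (by positivity) hy]
    refine setIntegral_congr_fun measurableSet_Ioi fun t ht => ?_
    exact (Real.norm_of_nonneg (mul_nonneg (hy.trans (le_of_lt ht)) (Real.exp_nonneg _))).symm
  have hswap := integral_integral_swap hint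
  have hl : ∀ u : ℝ, ∫ t in Set.Ioi y, t * Real.exp (-(t ^ 2 * (1 + u ^ 2) / 2)) =
      Real.exp (-(y ^ 2 * (1 + u ^ 2) / 2)) / (1 + u ^ 2) := fun u =>
    integral_Ioi_mul_exp_neg_sq_mul (by positivity) hy
  simp_rw [hl] at hswap
  rw [hswap, setIntegral_congr_fun measurableSet_Ioi fun t ht =>
    integral_Ioi_zero_mul_exp_neg_sq_mul (hy.trans_lt ht), integral_const_mul, measureReal_def,
    gaussianReal_apply_eq_integral _ one_ne_zero, ENNReal.toReal_ofReal
      (integral_nonneg fun _ => gaussianPDFReal_nonneg _ _ _)]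
  simp only [gaussianPDFReal, NNReal.coe_one, mul_one, sub_zero]
  rw [integral_const_mul, ← mul_assoc]
  congr 1
  have : √(2 * Real.pi) ^ 2 = 2 * Real.pi := Real.sq_sqrt (by positivity)
  field_simp
  linarith

theorem mgf_sq_gaussianReal {s : ℝ} (hs : 0 ≤ s) :
    mgf (fun z : ℝ => z ^ 2) (gaussianReal 0 1) (-s) = (1 + 2 * s) ^ (-(1 / 2) : ℝ) := by
  have h0 : 0 < 1 + 2 * s := by linarith
  rw [mgf, integral_gaussianReal_eq_integral_smul (by norm_num)]
  have : ∀ z : ℝ, gaussianPDFReal 0 1 z • Real.exp (-s * z ^ 2) =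
      (√(2 * Real.pi))⁻¹ * Real.exp (-(1 / 2 + s) * z ^ 2) := by
    intro z
    simp only [gaussianPDFReal, smul_eq_mul, NNReal.coe_one, mul_one, sub_zero, mul_assoc,
      ← Real.exp_add]
    congr 2
    ring
  simp_rw [this]
  rw [integral_const_mul, integral_gaussian, ← Real.sqrt_inv, ← Real.sqrt_mul (by positivity),
    Real.rpow_neg h0.le, ← Real.sqrt_eq_rpow, ← Real.sqrt_inv]
  congr 1
  field_simp

/-! ### Gaussian tail at an independent random level -/

section Probability

variable {Ω : Type*} [MeasurableSpace Ω] {P : Measure Ω}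

/-- Conditionally on W, Craig's formula at the level a√W has an exponent linear in W; exchanging
expectation and integral produces the mgf. -/
theorem measureReal_gt_mul_sqrt_eq_integral [IsProbabilityMeasure P] {Z W : Ω → ℝ}
    (hZ : HasLaw Z (gaussianReal 0 1) P) (hW : AEMeasurable W P) (hW0 : ∀ ω, 0 ≤ W ω)
    (hZW : IndepFun Z W P) {a : ℝ} (ha : 0 ≤ a) :
    P.real {ω | a * √(W ω) < Z ω} =
      Real.pi⁻¹ * ∫ u in Set.Ioi (0 : ℝ), mgf W P (-(a ^ 2 * (1 + u ^ 2) / 2)) / (1 + u ^ 2) := by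
  have hmeas : MeasurableSet {p : ℝ × ℝ | a * √p.1 < p.2} :=
    measurableSet_lt (by fun_prop) (by fun_prop)
  have hprob : IsProbabilityMeasure (P.map W) := Measure.isProbabilityMeasure_map hW
  have hmap : P.map (fun ω => (W ω, Z ω)) = (P.map W).prod (gaussianReal 0 1) := by
    rw [(indepFun_iff_map_prod_eq_prod_map_map hW hZ.aemeasurable).1 hZW.symm, hZ.map_eq]
  have h1 : P.real {ω | a * √(W ω) < Z ω} =
      ∫ w, (gaussianReal 0 1).real (Set.Ioi (a * √w)) ∂(P.map W) := by
    have : P {ω | a * √(W ω) < Z ω} =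
        P.map (fun ω => (W ω, Z ω)) {p : ℝ × ℝ | a * √p.1 < p.2} := by
      rw [Measure.map_apply_of_aemeasurable (hW.prodMk hZ.aemeasurable) hmeas]
      rfl
    rw [measureReal_def, this, hmap, Measure.prod_apply hmeas, ← integral_toReal]
    · rfl
    · exact (measurable_measure_prodMk_left hmeas).aemeasurable
    · exact ae_of_all _ fun _ => measure_lt_top _ _
  have h2 : ∀ ω, (gaussianReal 0 1).real (Set.Ioi (a * √(W ω))) =
      Real.pi⁻¹ * ∫ u in Set.Ioi (0 : ℝ),
        Real.exp (-(a ^ 2 * (1 + u ^ 2) / 2) * W ω) / (1 + u ^ 2) := by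
    intro ω
    rw [gaussianReal_Ioi_eq_integral (by positivity), mul_pow, Real.sq_sqrt (hW0 ω)]
    congr! 5
    ring
  have hsm : StronglyMeasurable fun w => (gaussianReal 0 1).real (Set.Ioi (a * √w)) :=
    (measurable_measure_prodMk_left hmeas).ennreal_toReal.stronglyMeasurable
  rw [h1, integral_map hW hsm.aestronglyMeasurable]
  simp_rw [h2]
  rw [integral_const_mul, integral_integral_swap]
  · simp_rw [integral_div]
    rfl
  · refine ((integrable_inv_one_add_sq.restrict (s := Set.Ioi (0 : ℝ))).comp_snd P).mono'
      ?_ (ae_of_all _ fun p => ?_)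
    · have hW1 : AEMeasurable (fun p : Ω × ℝ => W p.1) (P.prod (volume.restrict (Set.Ioi 0))) :=
        hW.comp_fst
      refine AEMeasurable.aestronglyMeasurable ?_
      unfold Function.uncurry
      fun_prop
    · simp only [Function.uncurry]
      rw [Real.norm_of_nonneg (by positivity), div_eq_mul_inv]
      refine mul_le_of_le_one_left (by positivity) (Real.exp_le_one_iff.2 ?_)
      have : 0 ≤ a ^ 2 * (1 + p.2 ^ 2) / 2 * W p.1 := mul_nonneg (by positivity) (hW0 _)
      linarith

end Probability

/-! ### Sum and deviations of a standard normal sample; the exact tail -/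

section Probability

variable {Ω : Type*} [MeasurableSpace Ω] {P : Measure Ω}

theorem ProbabilityTheory.HasLaw.mgf_sq_stdNormal {Z : Ω → ℝ} (hZ : HasLaw Z (gaussianReal 0 1) P)
    {s : ℝ} (hs : 0 ≤ s) :
    mgf (fun ω => Z ω ^ 2) P (-s) = (1 + 2 * s) ^ (-(1 / 2) : ℝ) := by
  rw [← mgf_sq_gaussianReal hs, mgf, mgf,
    ← hZ.integral_comp (f := fun z => Real.exp (-s * z ^ 2))
      (Measurable.aestronglyMeasurable (by fun_prop))]
  rfl

section IID

variable [IsProbabilityMeasure P] {ι : Type*} [Fintype ι] {Y : ι → Ω → ℝ}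

/-- Used twice: it gives Var S = n, and it makes S uncorrelated with each Y i − S/n. -/
theorem covariance_stdNormal_family (hY : ∀ i, HasLaw (Y i) (gaussianReal 0 1) P)
    (hindep : iIndepFun Y P) (i : ι) : cov[fun ω => ∑ j, Y j ω, Y i; P] = 1 := by
  classical
  have hmem : ∀ i, MemLp (Y i) 2 P := fun i => (hY i).hasGaussianLaw.memLp_two
  rw [covariance_fun_sum_left hmem (hmem i), Finset.sum_eq_single i]
  · rw [covariance_self (hY i).aemeasurable, (hY i).variance_eq, variance_id_gaussianReal]
    rfl
  · exact fun j _ hj => (hindep.indepFun hj).covariance_eq_zero (hmem j) (hmem i)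
  · simp

theorem covariance_sum_sum_stdNormal_family (hY : ∀ i, HasLaw (Y i) (gaussianReal 0 1) P)
    (hindep : iIndepFun Y P) :
    cov[fun ω => ∑ j, Y j ω, fun ω => ∑ j, Y j ω; P] = Fintype.card ι := by
  have hmem : ∀ i, MemLp (Y i) 2 P := fun i => (hY i).hasGaussianLaw.memLp_two
  rw [covariance_fun_sum_right hmem (memLp_finsetSum _ fun i _ => hmem i)]
  simp [covariance_stdNormal_family hY hindep]

theorem hasLaw_sum_div_sqrt_card [Nonempty ι] (hY : ∀ i, HasLaw (Y i) (gaussianReal 0 1) P)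
    (hindep : iIndepFun Y P) :
    HasLaw (fun ω => (∑ i, Y i ω) / √(Fintype.card ι : ℝ)) (gaussianReal 0 1) P := by
  have hmem : ∀ i, MemLp (Y i) 2 P := fun i => (hY i).hasGaussianLaw.memLp_two
  have hS : HasGaussianLaw (fun ω => ∑ i, Y i ω) P :=
    hindep.hasGaussianLaw_fun_sum fun i => (hY i).hasGaussianLaw
  have hmean : ∫ ω, ∑ i, Y i ω ∂P = 0 := by
    rw [integral_finsetSum _ fun i _ => (hY i).hasGaussianLaw.integrable]
    refine Finset.sum_eq_zero fun i _ => ?_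
    rw [(hY i).integral_eq, integral_id_gaussianReal]
  have hlaw : HasLaw (fun ω => ∑ i, Y i ω) (gaussianReal 0 (Fintype.card ι)) P := by
    refine ⟨hS.aemeasurable, ?_⟩
    rw [hS.map_eq_gaussianReal, hmean, ← covariance_self hS.aemeasurable,
      covariance_sum_sum_stdNormal_family hY hindep]
    simp
  have hdiv := gaussianReal_div_const hlaw (√(Fintype.card ι : ℝ))
  convert hdiv using 2
  · simp
  · ext
    simp

theorem indepFun_sum_sum_sq_sub_mean [Nonempty ι] (hY : ∀ i, HasLaw (Y i) (gaussianReal 0 1) P)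
    (hindep : iIndepFun Y P) :
    IndepFun (fun ω => (∑ i, Y i ω) / √(Fintype.card ι : ℝ))
      (fun ω => ∑ i, (Y i ω - (∑ j, Y j ω) / Fintype.card ι) ^ 2) P := by
  have hmem : ∀ i, MemLp (Y i) 2 P := fun i => (hY i).hasGaussianLaw.memLp_two
  have hmemS : MemLp (fun ω => ∑ i, Y i ω) 2 P := memLp_finsetSum _ fun i _ => hmem i
  have hmemSdiv : MemLp (fun ω => (∑ i, Y i ω) / (Fintype.card ι : ℝ)) 2 P := by
    simpa [div_eq_inv_mul] using hmemS.const_mul (Fintype.card ι : ℝ)⁻¹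
  have hjoint := hindep.hasGaussianLaw fun i => (hY i).hasGaussianLaw
  -- The sum and the deviations form a linear image of a Gaussian vector, so zero covariance implies
  -- independence. The index `Unit` turns the sum into a family.
  let S : (ι → ℝ) →L[ℝ] ℝ := ∑ i, ContinuousLinearMap.proj i
  let L : (ι → ℝ) →L[ℝ] (Unit → ℝ) × (ι → ℝ) :=
    (ContinuousLinearMap.pi fun _ => S).prod
      (ContinuousLinearMap.pi fun i =>
        ContinuousLinearMap.proj i - (Fintype.card ι : ℝ)⁻¹ • S)
  have hpair : HasGaussianLaw (fun ω => ((fun _ : Unit => ∑ i, Y i ω),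
      fun i => Y i ω - (∑ j, Y j ω) / Fintype.card ι)) P := by
    have hL : (fun ω => ((fun _ : Unit => ∑ i, Y i ω),
        fun i => Y i ω - (∑ j, Y j ω) / Fintype.card ι)) = fun ω => L fun i => Y i ω := by
      ext ω <;> simp [L, S, div_eq_inv_mul]
    rw [hL]
    exact hjoint.map_fun L
  have hind := hpair.indepFun_of_covariance_eval (X := fun (_ : Unit) ω => ∑ i, Y i ω)
    (Y := fun i ω => Y i ω - (∑ j, Y j ω) / Fintype.card ι) (fun _ i => by
      rw [covariance_fun_sub_right hmemS (hmem i) hmemSdiv,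
        covariance_fun_div_right, covariance_stdNormal_family hY hindep,
        covariance_sum_sum_stdNormal_family hY hindep, div_self, sub_self]
      exact_mod_cast Fintype.card_ne_zero)
  exact hind.comp (φ := fun z : Unit → ℝ => z () / √(Fintype.card ι : ℝ))
    (ψ := fun y : ι → ℝ => ∑ i, y i ^ 2) (by fun_prop) (by fun_prop)

theorem sum_sq_eq_add_sum_sq_sub_mean [Nonempty ι] (y : ι → ℝ) :
    ∑ i, y i ^ 2 = ((∑ i, y i) / √(Fintype.card ι : ℝ)) ^ 2 +
      ∑ i, (y i - (∑ j, y j) / Fintype.card ι) ^ 2 := by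
  have hc : (0 : ℝ) < Fintype.card ι := by exact_mod_cast Fintype.card_pos
  simp_rw [sub_sq, Finset.sum_add_distrib, Finset.sum_sub_distrib, ← Finset.sum_mul,
    ← Finset.mul_sum]
  rw [div_pow, Real.sq_sqrt hc.le, Finset.sum_const, nsmul_eq_mul, Finset.card_univ]
  field_simp
  ring

/-- In V² = Z² + W the summands are independent, so the mgf of W is (1 + 2s)^(−n/2) divided by (1 +
2s)^(−1/2). -/
theorem mgf_sum_sq_sub_mean [Nonempty ι] (hY : ∀ i, HasLaw (Y i) (gaussianReal 0 1) P)
    (hindep : iIndepFun Y P) {s : ℝ} (hs : 0 ≤ s) :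
    mgf (fun ω => ∑ i, (Y i ω - (∑ j, Y j ω) / Fintype.card ι) ^ 2) P (-s) =
      (1 + 2 * s) ^ (-(((Fintype.card ι : ℝ) - 1) / 2)) := by
  have hm : ∀ i, AEMeasurable (Y i) P := fun i => (hY i).aemeasurable
  have h0 : 0 < 1 + 2 * s := by linarith
  have h1 : mgf (∑ i, fun ω => Y i ω ^ 2) P (-s) = (1 + 2 * s) ^ (-((Fintype.card ι : ℝ) / 2)) := by
    have hsq : iIndepFun (fun i ω => Y i ω ^ 2) P :=
      hindep.comp (fun _ y => y ^ 2) fun _ => by fun_prop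
    rw [hsq.mgf_sum₀ (fun i => (hm i).pow_const 2),
      Finset.prod_congr rfl fun i _ => (hY i).mgf_sq_stdNormal hs,
      Finset.prod_const, ← Real.rpow_mul_natCast h0.le, Finset.card_univ]
    congr 1
    ring
  have h2 : (∑ i, fun ω => Y i ω ^ 2) = (fun ω => ((∑ i, Y i ω) / √(Fintype.card ι : ℝ)) ^ 2) +
      fun ω => ∑ i, (Y i ω - (∑ j, Y j ω) / Fintype.card ι) ^ 2 := by
    ext ω
    simpa using sum_sq_eq_add_sum_sq_sub_mean fun i => Y i ω
  have hind : IndepFun (fun ω => ((∑ i, Y i ω) / √(Fintype.card ι : ℝ)) ^ 2)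
      (fun ω => ∑ i, (Y i ω - (∑ j, Y j ω) / Fintype.card ι) ^ 2) P :=
    (indepFun_sum_sum_sq_sub_mean hY hindep).comp (φ := fun z => z ^ 2) (ψ := id)
      (by fun_prop) measurable_id
  rw [h2, hind.mgf_add' (by fun_prop) (by fun_prop), (hasLaw_sum_div_sqrt_card hY hindep).mgf_sq_stdNormal hs] at h1
  have hne : (1 + 2 * s) ^ (-(1 / 2) : ℝ) ≠ 0 := (Real.rpow_pos_of_pos h0 _).ne'
  refine mul_left_cancel₀ hne (h1.trans ?_)
  rw [← Real.rpow_add h0]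
  congr 1
  ring

/-- The event `S / V > x` for `0 ≤ x < √n`, in terms of the independent pair formed by the
normalised sum and the sum of squared deviations from the mean. -/
theorem lt_div_sqrt_sum_sq_iff [Nonempty ι] (y : ι → ℝ) {x : ℝ} (hx : 0 ≤ x)
    (hxn : x ^ 2 < Fintype.card ι) :
    x < (∑ i, y i) / √(∑ i, y i ^ 2) ↔
      √(x ^ 2 / (Fintype.card ι - x ^ 2)) * √(∑ i, (y i - (∑ j, y j) / Fintype.card ι) ^ 2) <
        (∑ i, y i) / √(Fintype.card ι : ℝ) := by
  have hc : (0 : ℝ) < Fintype.card ι := by exact_mod_cast Fintype.card_pos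
  have hd : 0 < Fintype.card ι - x ^ 2 := by linarith
  have hV := sum_sq_eq_add_sum_sq_sub_mean y
  set c : ℝ := (Fintype.card ι : ℝ)
  set s := ∑ i, y i
  have hW0 : 0 ≤ ∑ i, (y i - s / c) ^ 2 := Finset.sum_nonneg fun _ _ => sq_nonneg _
  set W := ∑ i, (y i - s / c) ^ 2
  set V := ∑ i, y i ^ 2
  have hz : s = √c * (s / √c) := by field_simp
  set z := s / √c
  rw [← Real.sqrt_mul (by positivity)]
  have hV0 : 0 ≤ V := by rw [hV]; positivity
  have hkey : x ^ 2 * V < s ^ 2 ↔ x ^ 2 / (c - x ^ 2) * W < z ^ 2 := by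
    rw [hz, mul_pow, Real.sq_sqrt hc.le, hV, div_mul_eq_mul_div, div_lt_iff₀ hd]
    constructor <;> intro h <;> linarith
  -- For s ≤ 0 both sides fail because x ≥ 0; this covers V = 0, where the quotient is 0 by
  -- convention.
  rcases le_or_gt s 0 with hs | hs
  · have hz0 : z ≤ 0 := div_nonpos_of_nonpos_of_nonneg hs (Real.sqrt_nonneg _)
    refine iff_of_false (not_lt.2 ?_) (not_lt.2 (hz0.trans (Real.sqrt_nonneg _)))
    exact (div_nonpos_of_nonpos_of_nonneg hs (Real.sqrt_nonneg _)).trans hx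
  · have hz0 : 0 < z := by positivity
    have hVpos : 0 < V := by rw [hV]; positivity
    rw [lt_div_iff₀ (Real.sqrt_pos.2 hVpos), Real.sqrt_lt' hz0, ← hkey]
    rw [← abs_of_nonneg (by positivity : 0 ≤ x * √V), ← abs_of_pos hs, ← sq_lt_sq, mul_pow,
      Real.sq_sqrt hV0, abs_of_pos hs]

theorem measureReal_lt_sum_div_sqrt_sum_sq [Nonempty ι]
    (hY : ∀ i, HasLaw (Y i) (gaussianReal 0 1) P) (hindep : iIndepFun Y P) {x : ℝ} (hx : 0 ≤ x)
    (hxn : x ^ 2 < Fintype.card ι) :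
    P.real {ω | x < (∑ i, Y i ω) / √(∑ i, Y i ω ^ 2)} =
      Real.pi⁻¹ * ∫ u in Set.Ioi (0 : ℝ),
        (1 + x ^ 2 / (Fintype.card ι - x ^ 2) * (1 + u ^ 2)) ^ (-(((Fintype.card ι : ℝ) - 1) / 2)) /
          (1 + u ^ 2) := by
  have hm : ∀ i, AEMeasurable (Y i) P := fun i => (hY i).aemeasurable
  have hd : 0 < Fintype.card ι - x ^ 2 := by linarith
  simp_rw [lt_div_sqrt_sum_sq_iff _ hx hxn]
  rw [measureReal_gt_mul_sqrt_eq_integral (hasLaw_sum_div_sqrt_card hY hindep) (by fun_prop)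
    (fun ω => Finset.sum_nonneg fun _ _ => sq_nonneg _)
    (indepFun_sum_sum_sq_sub_mean hY hindep) (Real.sqrt_nonneg _)]
  congr 1
  refine setIntegral_congr_fun measurableSet_Ioi fun u _ => ?_
  rw [Real.sq_sqrt (by positivity), mgf_sum_sq_sub_mean hY hindep (by positivity)]
  congr 3
  ring

end IID

end Probability

/-! ### Reduction of both tail ratios to one deterministic function -/

/-- The upper tail at `x` of `S_n / V_n` for independent centred normal variables,
valid for `0 ≤ x < √n`. -/
noncomputable def selfNormalizedTail (n : ℕ) (x : ℝ) : ℝ :=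
  Real.pi⁻¹ * ∫ u in Set.Ioi (0 : ℝ),
    (1 + x ^ 2 / (n - x ^ 2) * (1 + u ^ 2)) ^ (-(((n : ℝ) - 1) / 2)) / (1 + u ^ 2)

/-- The ratio of the tail of `S_n / V_n` to the standard normal tail at a point `x ≥ 0`. -/
noncomputable def normalTailRatio (n : ℕ) (x : ℝ) : ℝ :=
  (if x ^ 2 < n then selfNormalizedTail n x else 0) / (gaussianReal 0 1).real (Set.Ioi x)

theorem one_sub_stdNormalCDF (x : ℝ) : 1 - stdNormalCDF x = (gaussianReal 0 1).real (Set.Ioi x) := by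
  rw [stdNormalCDF, cdf_eq_real, ← Set.compl_Iic, probReal_compl_eq_one_sub measurableSet_Iic]

theorem stdNormalCDF_neg (x : ℝ) : stdNormalCDF (-x) = 1 - stdNormalCDF x := by
  have h : (gaussianReal 0 1).map (fun x => -x) = gaussianReal 0 1 := by
    rw [gaussianReal_map_neg, neg_zero]
  have hna := nullSingletonClass_gaussianReal (μ := 0) one_ne_zero
  rw [one_sub_stdNormalCDF, stdNormalCDF, cdf_eq_real, measureReal_def, measureReal_def,
    ← h, Measure.map_apply measurable_neg measurableSet_Iic, h]
  congr 1
  have : (fun x : ℝ => -x) ⁻¹' Set.Iic (-x) = Set.Ici x := by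
    ext; simp
  rw [this]
  exact measure_congr Ioi_ae_eq_Ici.symm

/-- Cauchy–Schwarz. It empties the event when x² ≥ n, hence the value 0 in `normalTailRatio`. -/
theorem partialSum_div_selfNormalizer_le_sqrt {Ω : Type*} (X : ℕ → Ω → ℝ) (n : ℕ) (ω : Ω) :
    partialSum X n ω / selfNormalizer X n ω ≤ √n := by
  refine div_le_of_le_mul₀ (Real.sqrt_nonneg _) (Real.sqrt_nonneg _) ?_
  rw [selfNormalizer, ← Real.sqrt_mul (by positivity)]
  refine Real.le_sqrt_of_sq_le ?_
  simpa [partialSum] using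
    sq_sum_le_card_mul_sum_sq (s := Finset.range n) (f := fun i => X i ω)

section Probability

variable {Ω : Type*} [MeasurableSpace Ω] {P : Measure Ω} [IsProbabilityMeasure P]

theorem measureReal_selfNormalized_gt {σ : ℝ≥0} (hσ : 0 < σ) {X : ℕ → Ω → ℝ}
    (hlaw : ∀ i, HasLaw (X i) (gaussianReal 0 (σ ^ 2)) P) (hindep : iIndepFun X P) {n : ℕ}
    (hn : 0 < n) {x : ℝ} (hx : 0 ≤ x) (hxn : x ^ 2 < n) :
    P.real {ω | partialSum X n ω / selfNormalizer X n ω > x} = selfNormalizedTail n x := by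
  have hσ' : (0 : ℝ) < σ := hσ
  have : Nonempty (Fin n) := ⟨⟨0, hn⟩⟩
  have hY : ∀ i : Fin n, HasLaw (fun ω => X i ω / σ) (gaussianReal 0 1) P := by
    intro i
    convert gaussianReal_div_const (hlaw i) (σ : ℝ) using 2
    · simp
    · ext
      simp [hσ'.ne']
  have hind : iIndepFun (fun (i : Fin n) ω => X i ω / σ) P :=
    (hindep.precomp Fin.val_injective).comp (fun _ y => y / σ) fun _ => by fun_prop
  have h := measureReal_lt_sum_div_sqrt_sum_sq hY hind hx (by simpa using hxn)
  rw [Fintype.card_fin] at h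
  rw [selfNormalizedTail, ← h]
  congr 1
  ext ω
  have hs : (∑ i : Fin n, X i ω / σ) / √(∑ i : Fin n, (X i ω / σ) ^ 2) =
      partialSum X n ω / selfNormalizer X n ω := by
    simp_rw [div_pow]
    rw [← Finset.sum_div, ← Finset.sum_div, Real.sqrt_div' _ (by positivity), Real.sqrt_sq hσ'.le,
      div_div_div_cancel_right₀ hσ'.ne', partialSum, selfNormalizer, Finset.sum_range,
      Finset.sum_range]
  simp only [Set.mem_ofPred_eq, gt_iff_lt, hs]

theorem upperTailRatio_eq {σ : ℝ≥0} (hσ : 0 < σ) {X : ℕ → Ω → ℝ}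
    (hlaw : ∀ i, HasLaw (X i) (gaussianReal 0 (σ ^ 2)) P) (hindep : iIndepFun X P) {n : ℕ}
    (hn : 0 < n) {x : ℝ} (hx : 0 ≤ x) : upperTailRatio P X n x = normalTailRatio n x := by
  rw [upperTailRatio, normalTailRatio, one_sub_stdNormalCDF]
  split_ifs with hxn
  · rw [measureReal_selfNormalized_gt hσ hlaw hindep hn hx hxn]
  · have : {ω | partialSum X n ω / selfNormalizer X n ω > x} = ∅ := by
      ext ω
      simp only [Set.mem_ofPred_eq, Set.mem_empty_iff_false, iff_false, gt_iff_lt, not_lt]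
      exact (partialSum_div_selfNormalizer_le_sqrt X n ω).trans
        (Real.sqrt_le_iff.2 ⟨hx, not_lt.1 hxn⟩)
    rw [this, measureReal_empty]

theorem lowerTailRatio_eq {σ : ℝ≥0} (hσ : 0 < σ) {X : ℕ → Ω → ℝ}
    (hlaw : ∀ i, HasLaw (X i) (gaussianReal 0 (σ ^ 2)) P) (hindep : iIndepFun X P) {n : ℕ}
    (hn : 0 < n) {x : ℝ} (hx : 0 ≤ x) : lowerTailRatio P X n x = normalTailRatio n x := by
  have hlaw' : ∀ i, HasLaw (fun ω => -X i ω) (gaussianReal 0 (σ ^ 2)) P := by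
    intro i
    simpa using! gaussianReal_neg (hlaw i)
  have hind : iIndepFun (fun i ω => -X i ω) P :=
    hindep.comp (fun _ y => -y) fun _ => measurable_neg
  rw [← upperTailRatio_eq hσ hlaw' hind hn hx, lowerTailRatio, upperTailRatio, stdNormalCDF_neg]
  congr 2
  ext ω
  have : partialSum (fun i ω => -X i ω) n ω / selfNormalizer (fun i ω => -X i ω) n ω =
      -(partialSum X n ω / selfNormalizer X n ω) := by
    simp [partialSum, selfNormalizer, neg_div]
  simp only [Set.mem_ofPred_eq, this, gt_iff_lt]
  exact lt_neg.symm

end Probability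

/-! ### Leading factors and uniform comparison for x ≥ 1 -/

/-- The integral carrying the correction to the leading term of `selfNormalizedTail n x`. -/
noncomputable def selfNormalizedMills (n : ℕ) (x : ℝ) : ℝ :=
  ∫ t in Set.Ioi (0 : ℝ), (1 + t ^ 2 / n) ^ (-(((n : ℝ) - 1) / 2)) / (1 + t ^ 2 / x ^ 2)

/-- The integral carrying the correction to the leading term of the normal tail. -/
noncomputable def normalMills (x : ℝ) : ℝ :=
  ∫ t in Set.Ioi (0 : ℝ), Real.exp (-(t ^ 2 / 2)) / (1 + t ^ 2 / x ^ 2)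

theorem gaussianReal_Ioi_eq_normalMills {x : ℝ} (hx : 0 < x) :
    (gaussianReal 0 1).real (Set.Ioi x) =
      Real.pi⁻¹ * (x⁻¹ * (Real.exp (-(x ^ 2 / 2)) * normalMills x)) := by
  have h := integral_comp_mul_left_Ioi
    (fun t : ℝ => Real.exp (-(t ^ 2 / 2)) / (1 + t ^ 2 / x ^ 2)) 0 hx
  rw [mul_zero, smul_eq_mul] at h
  rw [gaussianReal_Ioi_eq_integral hx.le, normalMills, mul_left_comm x⁻¹, ← h,
    ← integral_const_mul (Real.exp (-(x ^ 2 / 2)))]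
  congr 1
  refine setIntegral_congr_fun measurableSet_Ioi fun u _ => ?_
  rw [mul_pow, mul_div_cancel_left₀ _ (by positivity), ← mul_div_assoc, ← Real.exp_add]
  congr 2
  ring

theorem selfNormalizedTail_eq_selfNormalizedMills {n : ℕ} {x : ℝ} (hx : 0 < x)
    (hxn : x ^ 2 < n) :
    selfNormalizedTail n x =
      Real.pi⁻¹ * (x⁻¹ * ((1 - x ^ 2 / n) ^ (((n : ℝ) - 1) / 2) * selfNormalizedMills n x)) := by
  have hn : (0 : ℝ) < n := lt_trans (by positivity) hxn
  have hd : 0 < n - x ^ 2 := by linarith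
  have hy : 0 < 1 - x ^ 2 / n := by
    rw [sub_pos, div_lt_one hn]
    exact hxn
  have h := integral_comp_mul_left_Ioi
    (fun t : ℝ => (1 + t ^ 2 / n) ^ (-(((n : ℝ) - 1) / 2)) / (1 + t ^ 2 / x ^ 2)) 0 hx
  rw [mul_zero, smul_eq_mul] at h
  rw [selfNormalizedTail, selfNormalizedMills, mul_left_comm x⁻¹, ← h,
    ← integral_const_mul ((1 - x ^ 2 / (n : ℝ)) ^ (((n : ℝ) - 1) / 2))]
  congr 1
  refine setIntegral_congr_fun measurableSet_Ioi fun u _ => ?_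
  -- This factorisation separates the leading power from the integrand in t = xu.
  have hfac : 1 + x ^ 2 / (n - x ^ 2) * (1 + u ^ 2) =
      (1 - x ^ 2 / n)⁻¹ * (1 + (x * u) ^ 2 / n) := by
    field_simp
    ring
  rw [hfac, Real.mul_rpow (by positivity) (by positivity), Real.inv_rpow hy.le,
    Real.rpow_neg hy.le, inv_inv, mul_pow, mul_div_cancel_left₀ _ (by positivity), mul_div_assoc]

theorem normalTailRatio_eq {n : ℕ} {x : ℝ} (hx : 0 < x) (hxn : x ^ 2 < n) :
    normalTailRatio n x = (1 - x ^ 2 / n) ^ (((n : ℝ) - 1) / 2) * Real.exp (x ^ 2 / 2) *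
      (selfNormalizedMills n x / normalMills x) := by
  rw [normalTailRatio, if_pos hxn, selfNormalizedTail_eq_selfNormalizedMills hx hxn,
    gaussianReal_Ioi_eq_normalMills hx, mul_div_mul_left _ _ (by positivity),
    mul_div_mul_left _ _ (by positivity), Real.exp_neg]
  field_simp

/-- Bernoulli's inequality, which needs (n − 1)/2 ≥ 1, hence n ≥ 3; then (n − 1)/(2n) ≥ 1/4 gives a
majorant free of n. -/
theorem one_add_sq_div_rpow_le {n : ℕ} (hn : 3 ≤ n) (t : ℝ) :
    (1 + t ^ 2 / n) ^ (-(((n : ℝ) - 1) / 2)) ≤ 4 * (1 + t ^ 2)⁻¹ := by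
  have hn' : (3 : ℝ) ≤ n := by exact_mod_cast hn
  have h0 : 0 ≤ t ^ 2 / n := by positivity
  rw [Real.rpow_neg (by positivity), ← inv_inv (4 : ℝ), ← mul_inv]
  refine inv_anti₀ (by positivity) ?_
  refine le_trans ?_ (one_add_mul_self_le_rpow_one_add (by linarith)
    (by linarith : (1 : ℝ) ≤ (n - 1) / 2))
  have : ((n : ℝ) - 1) / 2 * (t ^ 2 / n) - 4⁻¹ * t ^ 2 = t ^ 2 * (n - 2) / (4 * n) := by
    field_simp
    ring
  have h1 : 0 ≤ t ^ 2 * (n - 2 : ℝ) / (4 * n) :=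
    div_nonneg (mul_nonneg (sq_nonneg t) (by linarith)) (by positivity)
  linarith

theorem exp_neg_sq_le (t : ℝ) : Real.exp (-(t ^ 2 / 2)) ≤ 4 * (1 + t ^ 2)⁻¹ := by
  rw [Real.exp_neg, ← inv_inv (4 : ℝ), ← mul_inv]
  refine inv_anti₀ (by positivity) ?_
  have := Real.add_one_le_exp (t ^ 2 / 2)
  nlinarith [sq_nonneg t]

theorem tendsto_one_add_sq_div_rpow (t : ℝ) :
    Tendsto (fun n : ℕ => (1 + t ^ 2 / n) ^ (-(((n : ℝ) - 1) / 2))) atTop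
      (𝓝 (Real.exp (-(t ^ 2 / 2)))) := by
  have h1 : Tendsto (fun n : ℕ => ((1 + t ^ 2 / n) ^ n) ^ (-(1 / 2) : ℝ)) atTop
      (𝓝 (Real.exp (t ^ 2) ^ (-(1 / 2) : ℝ))) :=
    (Real.tendsto_one_add_div_pow_exp (t ^ 2)).rpow_const (Or.inl (Real.exp_ne_zero _))
  have h2 : Tendsto (fun n : ℕ => (1 + t ^ 2 / n) ^ (1 / 2 : ℝ)) atTop (𝓝 1) := by
    have : Tendsto (fun n : ℕ => 1 + t ^ 2 / n) atTop (𝓝 (1 + 0)) :=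
      tendsto_const_nhds.add (tendsto_const_div_atTop_nhds_zero_nat _)
    simpa using this.rpow_const (p := 1 / 2) (by norm_num)
  have h3 := h1.mul h2
  rw [← Real.exp_mul, mul_one] at h3
  refine (h3.congr fun n => ?_).trans_eq ?_
  · have h0 : 0 < 1 + t ^ 2 / n := by positivity
    rw [← Real.rpow_natCast_mul h0.le, ← Real.rpow_add h0]
    congr 1
    ring
  · congr 2
    ring

theorem integrable_mul_inv_one_add_sq (c : ℝ) :
    IntegrableOn (fun t : ℝ => c * (1 + t ^ 2)⁻¹) (Set.Ioi 0) :=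
  (integrable_inv_one_add_sq.const_mul c).integrableOn

theorem integrable_selfNormalized {n : ℕ} (hn : 3 ≤ n) :
    IntegrableOn (fun t : ℝ => (1 + t ^ 2 / n) ^ (-(((n : ℝ) - 1) / 2))) (Set.Ioi 0) :=
  (integrable_mul_inv_one_add_sq 4).mono' (Measurable.aestronglyMeasurable (by fun_prop))
    (ae_of_all _ fun t => by
      rw [Real.norm_of_nonneg (by positivity)]
      exact one_add_sq_div_rpow_le hn t)

theorem integrable_exp_neg_sq :
    IntegrableOn (fun t : ℝ => Real.exp (-(t ^ 2 / 2))) (Set.Ioi 0) :=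
  (integrable_mul_inv_one_add_sq 4).mono' (Measurable.aestronglyMeasurable (by fun_prop))
    (ae_of_all _ fun t => by
      rw [Real.norm_of_nonneg (by positivity)]
      exact exp_neg_sq_le t)

theorem MeasureTheory.IntegrableOn.div_one_add_sq_div_sq {f : ℝ → ℝ} {s : Set ℝ}
    (hf : IntegrableOn f s) (x : ℝ) :
    IntegrableOn (fun t => f t / (1 + t ^ 2 / x ^ 2)) s := by
  simp_rw [div_eq_inv_mul (f _)]
  refine hf.bdd_mul (c := 1) (Measurable.aestronglyMeasurable (by fun_prop))
    (ae_of_all _ fun t => ?_)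
  rw [Real.norm_of_nonneg (by positivity)]
  exact inv_le_one_of_one_le₀ (le_add_of_nonneg_right (by positivity))

/-- The weight 1/(1 + t²/x²) is at most 1, so the bound is free of x: this is the source of
uniformity. -/
theorem abs_selfNormalizedMills_sub_normalMills_le {n : ℕ} (hn : 3 ≤ n) (x : ℝ) :
    |selfNormalizedMills n x - normalMills x| ≤ ∫ t in Set.Ioi (0 : ℝ),
      |(1 + t ^ 2 / n) ^ (-(((n : ℝ) - 1) / 2)) - Real.exp (-(t ^ 2 / 2))| := by
  rw [selfNormalizedMills, normalMills, ← integral_sub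
    ((integrable_selfNormalized hn).div_one_add_sq_div_sq x)
    (integrable_exp_neg_sq.div_one_add_sq_div_sq x)]
  refine (abs_integral_le_integral_abs).trans (integral_mono_of_nonneg
    (ae_of_all _ fun t => abs_nonneg _) ((integrable_selfNormalized hn).sub
      integrable_exp_neg_sq).abs (ae_of_all _ fun t => ?_))
  dsimp only
  rw [← sub_div, abs_div]
  refine div_le_self (abs_nonneg _) ?_
  rw [abs_of_nonneg (by positivity)]
  exact le_add_of_nonneg_right (by positivity)

theorem tendsto_integral_abs_selfNormalized_sub :
    Tendsto (fun n : ℕ => ∫ t in Set.Ioi (0 : ℝ),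
      |(1 + t ^ 2 / n) ^ (-(((n : ℝ) - 1) / 2)) - Real.exp (-(t ^ 2 / 2))|) atTop (𝓝 0) := by
  have h := tendsto_integral_filter_of_dominated_convergence (l := atTop)
    (μ := volume.restrict (Set.Ioi (0 : ℝ)))
    (F := fun (n : ℕ) (t : ℝ) =>
      |(1 + t ^ 2 / n) ^ (-(((n : ℝ) - 1) / 2)) - Real.exp (-(t ^ 2 / 2))|)
    (f := fun _ => 0) (fun t : ℝ => 8 * (1 + t ^ 2)⁻¹)
    (Eventually.of_forall fun n => Measurable.aestronglyMeasurable (by fun_prop)) ?_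
    (integrable_mul_inv_one_add_sq 8) (ae_of_all _ fun t => ?_)
  · simpa using h
  · filter_upwards [eventually_ge_atTop 3] with n hn
    refine ae_of_all _ fun t => ?_
    rw [Real.norm_eq_abs, abs_abs]
    refine (abs_sub _ _).trans ?_
    rw [abs_of_nonneg (by positivity), abs_of_nonneg (by positivity)]
    linarith [one_add_sq_div_rpow_le hn t, exp_neg_sq_le t]
  · have h := ((tendsto_one_add_sq_div_rpow t).sub_const (Real.exp (-(t ^ 2 / 2)))).abs
    rwa [sub_self, abs_zero] at h

theorem gaussianReal_Ioi_pos (x : ℝ) : 0 < (gaussianReal 0 1).real (Set.Ioi x) := by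
  refine ENNReal.toReal_pos (fun h => ?_) (measure_ne_top _ _)
  simpa using gaussianReal_absolutelyContinuous' 0 one_ne_zero h

theorem normalMills_one_pos : 0 < normalMills 1 := by
  have h := gaussianReal_Ioi_pos 1
  rw [gaussianReal_Ioi_eq_normalMills one_pos] at h
  exact pos_of_mul_pos_right (by simpa using pos_of_mul_pos_right h (by positivity)) (Real.exp_nonneg _)

/-- Keeps the denominator away from 0 uniformly, which is where x ≥ 1 enters. -/
theorem normalMills_one_le {x : ℝ} (hx : 1 ≤ x) : normalMills 1 ≤ normalMills x := by
  refine integral_mono (integrable_exp_neg_sq.div_one_add_sq_div_sq 1)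
    (integrable_exp_neg_sq.div_one_add_sq_div_sq x) fun t => ?_
  have hx2 : (1 : ℝ) ^ 2 ≤ x ^ 2 := by gcongr
  dsimp only
  gcongr

/-- The two correction integrals are asymptotically equal, uniformly in `x ≥ 1`. -/
theorem tendsto_selfNormalizedMills_div_normalMills {x : ℕ → ℝ} (hx : ∀ n, 1 ≤ x n) :
    Tendsto (fun n => selfNormalizedMills n (x n) / normalMills (x n)) atTop (𝓝 1) := by
  have hpos := normalMills_one_pos
  have h := tendsto_integral_abs_selfNormalized_sub.div_const (normalMills 1)
  rw [zero_div] at h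
  rw [tendsto_iff_norm_sub_tendsto_zero]
  refine squeeze_zero' (Eventually.of_forall fun n => norm_nonneg _) ?_ h
  filter_upwards [eventually_ge_atTop 3] with n hn
  have hx' := hpos.trans_le (normalMills_one_le (hx n))
  rw [div_sub_one hx'.ne', norm_div, Real.norm_eq_abs, Real.norm_of_nonneg hx'.le]
  exact div_le_div₀ (integral_nonneg fun t => abs_nonneg _)
    (abs_selfNormalizedMills_sub_normalMills_le hn _) hpos (normalMills_one_le (hx n))

/-! ### The range 0 ≤ x ≤ 1 -/

theorem rpow_sub_exp_mem_Icc {n : ℕ} (hn : 3 ≤ n) {x : ℝ} (hx0 : 0 ≤ x) (hx1 : x ≤ 1) {w : ℝ}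
    (hw : 1 ≤ w) :
    (1 + x ^ 2 / (n - x ^ 2) * w) ^ (-(((n : ℝ) - 1) / 2)) - Real.exp (-(x ^ 2 * w / 2)) ∈
      Set.Icc 0 (w ^ 2 / ((n : ℝ) - 1)) := by
  have hn' : (3 : ℝ) ≤ n := by exact_mod_cast hn
  have hx2 : x ^ 2 ≤ 1 := pow_le_one₀ hx0 hx1
  have hx2' := sq_nonneg x
  have hd : 0 < n - x ^ 2 := by linarith
  have hm : (0 : ℝ) < n - 1 := by linarith
  set z := x ^ 2 / (n - x ^ 2) * w with hz
  have hz0 : 0 ≤ z := by positivity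
  have hzw : z ≤ w / (n - 1) := by
    rw [hz, div_mul_eq_mul_div, div_le_div_iff₀ hd hm]
    have : 0 ≤ w * n * (1 - x ^ 2) := mul_nonneg (by positivity) (by linarith)
    linarith
  have hpos : 0 < 1 + z := by linarith
  set p := ((n : ℝ) - 1) / 2 * Real.log (1 + z)
  have hup : Real.log (1 + z) ≤ z := by
    linarith [Real.log_le_sub_one_of_pos hpos]
  have hlow : z - z ^ 2 ≤ Real.log (1 + z) := by
    refine le_trans ?_ (Real.one_sub_inv_le_log_of_pos hpos)
    rw [le_sub_iff_add_le, ← le_sub_iff_add_le', inv_le_iff_one_le_mul₀ hpos]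
    nlinarith [pow_nonneg hz0 3]
  -- From (n − x²)z = x²w. The correction has a sign because x ≤ 1, which makes the difference of
  -- exponentials nonnegative.
  have hzid : ((n : ℝ) - 1) / 2 * z = x ^ 2 * w / 2 - (1 - x ^ 2) / 2 * z := by
    rw [hz]
    field_simp
    ring
  have hp1 : p ≤ x ^ 2 * w / 2 := by
    have h1 : p ≤ ((n : ℝ) - 1) / 2 * z := mul_le_mul_of_nonneg_left hup (by positivity)
    have h2 : 0 ≤ (1 - x ^ 2) / 2 * z := mul_nonneg (by linarith) hz0
    linarith
  have hp2 : x ^ 2 * w / 2 - p ≤ w ^ 2 / ((n : ℝ) - 1) := by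
    have h1 : ((n : ℝ) - 1) / 2 * (z - z ^ 2) ≤ p := mul_le_mul_of_nonneg_left hlow (by positivity)
    have h2 : (1 - x ^ 2) / 2 * z ≤ 1 / 2 * (w / (n - 1)) :=
      mul_le_mul (by linarith) hzw hz0 (by norm_num)
    have h3 : ((n : ℝ) - 1) / 2 * z ^ 2 ≤ 1 / 2 * (w ^ 2 / (n - 1)) := by
      have : z ^ 2 ≤ (w / (n - 1)) ^ 2 := by gcongr
      calc ((n : ℝ) - 1) / 2 * z ^ 2 ≤ ((n : ℝ) - 1) / 2 * (w / (n - 1)) ^ 2 := by gcongr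
        _ = 1 / 2 * (w ^ 2 / (n - 1)) := by field_simp
    have h4 : w / ((n : ℝ) - 1) ≤ w ^ 2 / (n - 1) := by
      gcongr
      nlinarith
    linarith
  have hp0 : 0 ≤ p := mul_nonneg (by linarith) (Real.log_nonneg (by linarith))
  have hrw : (1 + z) ^ (-(((n : ℝ) - 1) / 2)) = Real.exp (-p) := by
    rw [Real.rpow_def_of_pos hpos]
    congr 1
    ring
  rw [hrw]
  refine ⟨sub_nonneg.2 (Real.exp_le_exp.2 (by linarith)), le_trans ?_ hp2⟩
  have h1 : Real.exp (-(x ^ 2 * w / 2)) = Real.exp (-p) * Real.exp (p - x ^ 2 * w / 2) := by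
    rw [← Real.exp_add]
    congr 1
    ring
  have h2 := Real.add_one_le_exp (p - x ^ 2 * w / 2)
  have h3 : Real.exp (-p) ≤ 1 := Real.exp_le_one_iff.2 (by linarith)
  have h4 := Real.exp_pos (-p)
  rw [h1]
  nlinarith

/-- On [0, 1] the normal tail is at least its value at 1, so convergence of the difference suffices
for the ratio. -/
theorem tendsto_selfNormalizedTail_sub {x : ℕ → ℝ} (hx0 : ∀ n, 0 ≤ x n) (hx1 : ∀ n, x n ≤ 1) :
    Tendsto (fun n => selfNormalizedTail n (x n) - (gaussianReal 0 1).real (Set.Ioi (x n)))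
      atTop (𝓝 0) := by
  have hbound : ∀ (n : ℕ), 3 ≤ n → ∀ u : ℝ,
      (1 + x n ^ 2 / (n - x n ^ 2) * (1 + u ^ 2)) ^ (-(((n : ℝ) - 1) / 2)) ≤ 1 := by
    intro n hn u
    have hn' : (3 : ℝ) ≤ n := by exact_mod_cast hn
    have : x n ^ 2 ≤ 1 := pow_le_one₀ (hx0 n) (hx1 n)
    have hd : 0 < n - x n ^ 2 := by linarith
    exact Real.rpow_le_one_of_one_le_of_nonpos
      (le_add_of_nonneg_right (by positivity)) (by linarith)
  have hnn : ∀ (n : ℕ), 3 ≤ n → ∀ u : ℝ,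
      0 ≤ (1 + x n ^ 2 / (n - x n ^ 2) * (1 + u ^ 2)) ^ (-(((n : ℝ) - 1) / 2)) := by
    intro n hn u
    have hn' : (3 : ℝ) ≤ n := by exact_mod_cast hn
    have : x n ^ 2 ≤ 1 := pow_le_one₀ (hx0 n) (hx1 n)
    have hd : 0 < n - x n ^ 2 := by linarith
    positivity
  have hlim := tendsto_integral_filter_of_dominated_convergence (l := atTop)
    (μ := volume.restrict (Set.Ioi (0 : ℝ)))
    (F := fun (n : ℕ) (u : ℝ) =>
      ((1 + x n ^ 2 / (n - x n ^ 2) * (1 + u ^ 2)) ^ (-(((n : ℝ) - 1) / 2)) -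
        Real.exp (-(x n ^ 2 * (1 + u ^ 2) / 2))) / (1 + u ^ 2))
    (f := fun _ => 0) (fun u : ℝ => (1 + u ^ 2)⁻¹)
    (Eventually.of_forall fun n => Measurable.aestronglyMeasurable (by fun_prop)) ?_
    integrable_inv_one_add_sq.integrableOn (ae_of_all _ fun u => ?_)
  · have hlim' := hlim.const_mul Real.pi⁻¹
    simp only [integral_zero, mul_zero] at hlim'
    refine hlim'.congr' ?_
    filter_upwards [eventually_ge_atTop 3] with n hn
    have hint : IntegrableOn (fun u : ℝ =>
        (1 + x n ^ 2 / (n - x n ^ 2) * (1 + u ^ 2)) ^ (-(((n : ℝ) - 1) / 2)) / (1 + u ^ 2))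
        (Set.Ioi 0) := by
      refine integrable_inv_one_add_sq.integrableOn.mono'
        (Measurable.aestronglyMeasurable (by fun_prop)) (ae_of_all _ fun u => ?_)
      rw [Real.norm_of_nonneg (div_nonneg (hnn n hn u) (by positivity)), div_eq_mul_inv]
      exact mul_le_of_le_one_left (by positivity) (hbound n hn u)
    rw [selfNormalizedTail, gaussianReal_Ioi_eq_integral (hx0 n), ← mul_sub,
      ← integral_sub hint integrable_exp_neg_div_one_add_sq.integrableOn]
    congr 1
    exact integral_congr_ae (ae_of_all _ fun u => sub_div _ _ _)
  · filter_upwards [eventually_ge_atTop 3] with n hn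
    refine ae_of_all _ fun u => ?_
    have h := rpow_sub_exp_mem_Icc hn (hx0 n) (hx1 n) (w := 1 + u ^ 2)
      (le_add_of_nonneg_right (sq_nonneg u))
    rw [Real.norm_of_nonneg (div_nonneg h.1 (by positivity)), div_eq_mul_inv]
    refine mul_le_of_le_one_left (by positivity) ?_
    linarith [hbound n hn u, Real.exp_pos (-(x n ^ 2 * (1 + u ^ 2) / 2))]
  · have hg : Tendsto (fun n : ℕ => (1 + u ^ 2) ^ 2 / ((n : ℝ) - 1) / (1 + u ^ 2)) atTop (𝓝 0) := by
      have : Tendsto (fun n : ℕ => (n : ℝ) - 1) atTop atTop :=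
        tendsto_atTop_add_const_right _ _ tendsto_natCast_atTop_atTop
      simpa using (this.const_div_atTop ((1 + u ^ 2) ^ 2)).div_const (1 + u ^ 2)
    refine squeeze_zero' ?_ ?_ hg
    all_goals
      filter_upwards [eventually_ge_atTop 3] with n hn
      have h := rpow_sub_exp_mem_Icc hn (hx0 n) (hx1 n) (w := 1 + u ^ 2)
        (le_add_of_nonneg_right (sq_nonneg u))
    · exact div_nonneg h.1 (by positivity)
    · exact div_le_div_of_nonneg_right h.2 (by positivity)

theorem tendsto_normalTailRatio_of_le_one {x : ℕ → ℝ} (hx0 : ∀ n, 0 ≤ x n) (hx1 : ∀ n, x n ≤ 1) :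
    Tendsto (fun n => normalTailRatio n (x n)) atTop (𝓝 1) := by
  have h := (tendsto_selfNormalizedTail_sub hx0 hx1).norm.div_const
    ((gaussianReal 0 1).real (Set.Ioi 1))
  rw [norm_zero, zero_div] at h
  rw [tendsto_iff_norm_sub_tendsto_zero]
  refine squeeze_zero' (Eventually.of_forall fun n => norm_nonneg _) ?_ h
  filter_upwards [eventually_ge_atTop 3] with n hn
  have hn' : (3 : ℝ) ≤ n := by exact_mod_cast hn
  have hx2 : x n ^ 2 < n := (pow_le_one₀ (hx0 n) (hx1 n)).trans_lt (by linarith)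
  have hpos := gaussianReal_Ioi_pos (x n)
  rw [normalTailRatio, if_pos hx2, div_sub_one hpos.ne', norm_div, Real.norm_of_nonneg hpos.le]
  exact div_le_div_of_nonneg_left (norm_nonneg _) (gaussianReal_Ioi_pos 1)
    (measureReal_mono (Set.Ioi_subset_Ioi (hx1 n)))

/-! ### Expansion of the leading factor -/

theorem tendsto_log_one_sub_add_div_sq {y : ℕ → ℝ} (hy0 : ∀ᶠ n in atTop, 0 < y n)
    (hy : Tendsto y atTop (𝓝 0)) :
    Tendsto (fun n => -2 * (Real.log (1 - y n) + y n) / y n ^ 2 - 1) atTop (𝓝 0) := by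
  have hlim : Tendsto (fun n => 2 * y n / (1 - y n)) atTop (𝓝 0) := by
    have := (hy.const_mul 2).div (hy.const_sub 1) (by norm_num)
    rwa [mul_zero, zero_div] at this
  refine squeeze_zero_norm' ?_ hlim
  filter_upwards [hy0, hy.eventually_lt_const one_pos] with n h0 h1
  have h := Real.abs_log_sub_add_sum_range_le (x := y n) (by rwa [abs_of_pos h0]) 2
  simp only [Finset.sum_range_succ, Finset.sum_range_zero, abs_of_pos h0] at h
  norm_num at h
  have hd : 0 < 1 - y n := by linarith
  have : -2 * (Real.log (1 - y n) + y n) / y n ^ 2 - 1 =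
      -2 * (y n + y n ^ 2 / 2 + Real.log (1 - y n)) / y n ^ 2 := by
    field_simp
    ring
  rw [this, Real.norm_eq_abs, abs_div, abs_mul, abs_of_pos (pow_pos h0 2), div_le_iff₀ (by positivity)]
  norm_num
  calc _ ≤ 2 * (y n ^ 3 / (1 - y n)) := by linarith
    _ = _ := by field_simp

theorem normalTailRatio_expansion {x : ℕ → ℝ} (hx1 : ∀ n, 1 ≤ x n)
    (hx : Tendsto (fun n : ℕ => x n ^ 2 / (n : ℝ)) atTop (𝓝 0)) :
    ∃ ε η : ℕ → ℝ, Tendsto ε atTop (𝓝 0) ∧ Tendsto η atTop (𝓝 0) ∧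
      ∀ᶠ n : ℕ in atTop, normalTailRatio n (x n) =
        Real.exp (-(x n ^ 4 / (4 * (n : ℝ))) * (1 + ε n)) * (1 + η n) := by
  have hx0 : ∀ n, 0 < x n := fun n => one_pos.trans_le (hx1 n)
  -- ε is the relative error in log(1 − y) + y ≈ −y²/2. η takes the ratio of correction integrals
  -- and the factor (1 − y)^(−1/2) left by the exponent (n − 1)/2 in place of n/2.
  refine ⟨_, fun n => (1 - x n ^ 2 / (n : ℝ)) ^ (-(1 / 2) : ℝ) *
    (selfNormalizedMills n (x n) / normalMills (x n)) - 1,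
    tendsto_log_one_sub_add_div_sq ?_ hx, ?_, ?_⟩
  · filter_upwards [eventually_gt_atTop 0] with n hn
    have := hx0 n
    positivity
  · have h1 := ((hx.const_sub 1).rpow_const (p := -(1 / 2)) (by norm_num)).mul
      (tendsto_selfNormalizedMills_div_normalMills hx1)
    simpa using h1.sub_const 1
  · filter_upwards [eventually_gt_atTop 0, hx.eventually_lt_const one_pos] with n hn hlt
    have hn' : (0 : ℝ) < n := by exact_mod_cast hn
    have hd : 0 < 1 - x n ^ 2 / n := by linarith
    have hxn := hx0 n
    rw [normalTailRatio_eq hxn ((div_lt_one hn').1 hlt), add_sub_cancel, add_sub_cancel,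
      ← mul_assoc]
    congr 1
    rw [Real.rpow_def_of_pos hd, Real.rpow_def_of_pos hd, ← Real.exp_add, ← Real.exp_add]
    congr 1
    field_simp
    ring

/-! ### Necessity and sufficiency of x⁴/n → 0 for x ≥ 1 -/

/-- The series of −log(1 − y) has nonnegative terms, so truncating it gives a bound on all of [0,
1). -/
theorem log_one_sub_le {y : ℝ} (hy0 : 0 ≤ y) (hy1 : y < 1) :
    Real.log (1 - y) ≤ -y - y ^ 2 / 2 := by
  have h := sum_le_hasSum (Finset.range 2) (fun i _ => by positivity)
    (Real.hasSum_pow_div_log_of_abs_lt_one (by rwa [abs_of_nonneg hy0]))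
  simp only [Finset.sum_range_succ, Finset.sum_range_zero] at h
  norm_num at h
  linarith

theorem normalTailRatio_le {n : ℕ} (hn : 0 < n) {x : ℝ} (hx : 0 < x) (hxn : x ^ 2 < n) :
    normalTailRatio n x ≤
      Real.exp (x ^ 2 / n / 2 - ((n : ℝ) - 1) / 4 * (x ^ 2 / n) ^ 2) *
        (selfNormalizedMills n x / normalMills x) := by
  have hn' : (1 : ℝ) ≤ n := by exact_mod_cast hn
  have hy1 : x ^ 2 / n < 1 := (div_lt_one (by linarith)).2 hxn
  have hlog := log_one_sub_le (by positivity) hy1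
  rw [normalTailRatio_eq hx hxn, Real.rpow_def_of_pos (by linarith), ← Real.exp_add]
  have hM : 0 ≤ selfNormalizedMills n x := integral_nonneg fun t => by positivity
  have hN : 0 ≤ normalMills x := integral_nonneg fun t => by positivity
  refine mul_le_mul_of_nonneg_right (Real.exp_le_exp.2 ?_) (div_nonneg hM hN)
  have h2 : x ^ 2 / 2 = ((n : ℝ) - 1) / 2 * (x ^ 2 / n) + x ^ 2 / n / 2 := by
    field_simp
    ring
  have h3 := mul_le_mul_of_nonneg_left hlog (by linarith : 0 ≤ ((n : ℝ) - 1) / 2)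
  rw [h2]
  linarith

theorem tendsto_pow_four_div_of_tendsto_normalTailRatio {x : ℕ → ℝ} (hx1 : ∀ n, 1 ≤ x n)
    (h : Tendsto (fun n => normalTailRatio n (x n)) atTop (𝓝 1)) :
    Tendsto (fun n : ℕ => x n ^ 4 / (n : ℝ)) atTop (𝓝 0) := by
  set q := fun n => selfNormalizedMills n (x n) / normalMills (x n) with hq
  have hq1 : Tendsto q atTop (𝓝 1) := tendsto_selfNormalizedMills_div_normalMills hx1
  set y := fun n : ℕ => x n ^ 2 / (n : ℝ) with hy
  set δ := fun n => -Real.log (normalTailRatio n (x n) / q n) with hδ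
  have hδ0 : Tendsto δ atTop (𝓝 0) := by
    simpa using ((h.div hq1 one_ne_zero).log (by norm_num)).neg
  have hy0 : ∀ n, 0 ≤ y n := fun n => by positivity
  -- A positive ratio forces x² < n; the logarithm of `normalTailRatio_le`, times 4, gives the first
  -- bound.
  have hmain : ∀ᶠ n : ℕ in atTop, ((n : ℝ) - 1) * y n ^ 2 ≤ 2 * y n + 4 * δ n ∧ y n ≤ 1 := by
    filter_upwards [eventually_gt_atTop 0, h.eventually_const_lt one_pos,
      hq1.eventually_const_lt one_pos] with n hn hr hqn
    have hn' : (0 : ℝ) < n := by exact_mod_cast hn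
    have hxn : x n ^ 2 < n := by
      by_contra hcon
      rw [normalTailRatio, if_neg hcon, zero_div] at hr
      exact lt_irrefl _ hr
    have hle := normalTailRatio_le hn (one_pos.trans_le (hx1 n)) hxn
    rw [← div_le_iff₀ hqn] at hle
    have hlog := (Real.log_le_iff_le_exp (div_pos hr hqn)).2 hle
    refine ⟨?_, ((div_lt_one hn').2 hxn).le⟩
    simp only [hδ, hy, hq] at hlog ⊢
    linarith
  -- Bootstrap: the crude y ≤ 1 gives y → 0, which then makes the right side of `hmain` vanish in
  -- the limit.
  have hy_lim : Tendsto y atTop (𝓝 0) := by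
    have hinv : Tendsto (fun n : ℕ => (2 + 4 * δ n) / ((n : ℝ) - 1)) atTop (𝓝 0) :=
      ((hδ0.const_mul 4).const_add 2).div_atTop
        (tendsto_atTop_add_const_right _ _ tendsto_natCast_atTop_atTop)
    have hsq : Tendsto (fun n => y n ^ 2) atTop (𝓝 0) := by
      refine squeeze_zero' (Eventually.of_forall fun n => sq_nonneg _) ?_ hinv
      filter_upwards [hmain, eventually_gt_atTop 1] with n hn hn1
      have : (1 : ℝ) < n := by exact_mod_cast hn1
      rw [le_div_iff₀ (by linarith)]
      linarith [hn.1, hn.2]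
    have := hsq.sqrt
    simpa [Real.sqrt_sq (hy0 _)] using this
  have hup : Tendsto (fun n => 2 * (2 * y n + 4 * δ n)) atTop (𝓝 0) := by
    simpa using ((hy_lim.const_mul 2).add (hδ0.const_mul 4)).const_mul 2
  refine squeeze_zero' (Eventually.of_forall fun n => by positivity) ?_ hup
  filter_upwards [hmain, eventually_gt_atTop 1] with n hn hn1
  have hn2 : (2 : ℝ) ≤ n := by exact_mod_cast hn1
  have : x n ^ 4 / n = n * y n ^ 2 := by
    simp only [hy]
    field_simp
  rw [this]
  -- Here n ≤ 2(n − 1), whence the factor 2 in `hup`.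
  nlinarith [hn.1, sq_nonneg (y n)]

theorem tendsto_normalTailRatio_of_tendsto_pow_four_div {x : ℕ → ℝ} (hx1 : ∀ n, 1 ≤ x n)
    (h : Tendsto (fun n : ℕ => x n ^ 4 / (n : ℝ)) atTop (𝓝 0)) :
    Tendsto (fun n => normalTailRatio n (x n)) atTop (𝓝 1) := by
  have hsq : Tendsto (fun n : ℕ => x n ^ 2 / (n : ℝ)) atTop (𝓝 0) := by
    refine squeeze_zero (fun n => by positivity) (fun n => ?_) h
    gcongr
    · exact hx1 n
    · norm_num
  obtain ⟨ε, η, hε, hη, heq⟩ := normalTailRatio_expansion hx1 hsq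
  refine Tendsto.congr' (heq.mono fun n hn => hn.symm) ?_
  have h1 : Tendsto (fun n : ℕ => -(x n ^ 4 / (4 * (n : ℝ))) * (1 + ε n)) atTop (𝓝 0) := by
    have := ((h.div_const 4).neg).mul (hε.const_add 1)
    simp only [zero_div, neg_zero, zero_mul] at this
    refine this.congr fun n => ?_
    rw [div_div, mul_comm (4 : ℝ)]
  simpa using h1.rexp.mul (hη.const_add 1)

/-! ### Growth conditions, merging the two ranges, conclusion -/

theorem isLittleO_rpow_quarter_iff (x : ℕ → ℝ) :
    x =o[atTop] (fun n : ℕ => (n : ℝ) ^ (1 / 4 : ℝ)) ↔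
      Tendsto (fun n : ℕ => x n ^ 4 / (n : ℝ)) atTop (𝓝 0) := by
  have hpow : (fun n : ℕ => (n : ℝ) ^ (1 / 4 : ℝ)) ^ 4 = fun n : ℕ => (n : ℝ) := by
    ext n
    rw [Pi.pow_apply, ← Real.rpow_mul_natCast (by positivity)]
    norm_num
  have hiff : ((x ^ 4) =o[atTop] fun n : ℕ => (n : ℝ)) ↔
      Tendsto (fun n : ℕ => x n ^ 4 / (n : ℝ)) atTop (𝓝 0) := by
    refine isLittleO_iff_tendsto' ?_
    filter_upwards [eventually_gt_atTop 0] with n hn h0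
    exact absurd h0 (by exact_mod_cast hn.ne')
  rw [← hiff, ← hpow]
  exact ⟨fun h => h.pow (by norm_num), fun h => h.of_pow (by norm_num)⟩

theorem tendsto_sq_div_of_isLittleO_rpow_half {x : ℕ → ℝ}
    (hx : x =o[atTop] (fun n : ℕ => (n : ℝ) ^ (1 / 2 : ℝ))) :
    Tendsto (fun n : ℕ => x n ^ 2 / (n : ℝ)) atTop (𝓝 0) := by
  refine (hx.pow two_pos).tendsto_div_nhds_zero.congr fun n => ?_
  rw [← Real.rpow_mul_natCast (by positivity)]
  norm_num

theorem isLittleO_rpow_quarter_max_one_iff {x : ℕ → ℝ} (hx0 : ∀ n, 0 ≤ x n) :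
    (fun n => max (x n) 1) =o[atTop] (fun n : ℕ => (n : ℝ) ^ (1 / 4 : ℝ)) ↔
      x =o[atTop] (fun n : ℕ => (n : ℝ) ^ (1 / 4 : ℝ)) := by
  have hone : (fun _ : ℕ => (1 : ℝ)) =o[atTop] (fun n : ℕ => (n : ℝ) ^ (1 / 4 : ℝ)) := by
    rw [isLittleO_rpow_quarter_iff]
    exact tendsto_const_div_atTop_nhds_zero_nat _
  refine ⟨fun h => (IsBigO.of_bound' (Eventually.of_forall fun n => ?_)).trans_isLittleO h,
    fun h => (IsBigO.of_bound' (Eventually.of_forall fun n => ?_)).trans_isLittleO (h.add hone)⟩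
  · rw [Real.norm_of_nonneg (hx0 n)]
    exact (le_max_left _ _).trans (le_abs_self _)
  · have := hx0 n
    rw [Real.norm_of_nonneg (by positivity), Real.norm_of_nonneg (by positivity)]
    exact max_le (by linarith) (by linarith)

/-- The sequences differ only at indices with x n ≤ 1, where both ratios tend to 1 anyway;
interleaving with min(x, 1) or the constant 1 passes between them. -/
theorem tendsto_normalTailRatio_max_one_iff {x : ℕ → ℝ} (hx0 : ∀ n, 0 ≤ x n) :
    Tendsto (fun n => normalTailRatio n (max (x n) 1)) atTop (𝓝 1) ↔
      Tendsto (fun n => normalTailRatio n (x n)) atTop (𝓝 1) := by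
  classical
  have hmin := tendsto_normalTailRatio_of_le_one (x := fun n => min (x n) 1)
    (fun n => le_min (hx0 n) zero_le_one) fun n => min_le_right _ _
  have hone := tendsto_normalTailRatio_of_le_one (x := fun _ => 1)
    (fun _ => zero_le_one) fun _ => le_rfl
  constructor <;> intro h
  · refine (hmin.if' (p := fun n => x n ≤ 1) h).congr fun n => ?_
    split_ifs with hn
    · rw [min_eq_left hn]
    · rw [max_eq_left (not_le.1 hn).le]
  · refine (hone.if' (p := fun n => x n ≤ 1) h).congr fun n => ?_
    split_ifs with hn
    · rw [max_eq_right hn]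
    · rw [max_eq_left (not_le.1 hn).le]

theorem tendsto_normalTailRatio_iff {x : ℕ → ℝ} (hx0 : ∀ n, 0 ≤ x n) :
    Tendsto (fun n => normalTailRatio n (x n)) atTop (𝓝 1) ↔
      x =o[atTop] (fun n : ℕ => (n : ℝ) ^ (1 / 4 : ℝ)) := by
  rw [← tendsto_normalTailRatio_max_one_iff hx0, ← isLittleO_rpow_quarter_max_one_iff hx0,
    isLittleO_rpow_quarter_iff]
  exact ⟨tendsto_pow_four_div_of_tendsto_normalTailRatio fun n => le_max_right _ _,
    tendsto_normalTailRatio_of_tendsto_pow_four_div fun n => le_max_right _ _⟩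

theorem expansion_of_eventually_eq {r x : ℕ → ℝ} (hx : Tendsto x atTop atTop)
    (hxo : x =o[atTop] (fun n : ℕ => (n : ℝ) ^ (1 / 2 : ℝ)))
    (hr : ∀ᶠ n in atTop, r n = normalTailRatio n (x n)) :
    ∃ ε η : ℕ → ℝ, Tendsto ε atTop (𝓝 0) ∧ Tendsto η atTop (𝓝 0) ∧
      ∀ᶠ n in atTop, r n =
        Real.exp (-(x n ^ 4 / (4 * (n : ℝ))) * (1 + ε n)) * (1 + η n) := by
  have hmax : ∀ᶠ n in atTop, max (x n) 1 = x n := by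
    filter_upwards [hx.eventually_ge_atTop 1] with n hn using max_eq_left hn
  obtain ⟨ε, η, hε, hη, h⟩ := normalTailRatio_expansion (x := fun n => max (x n) 1)
    (fun n => le_max_right _ _)
    ((tendsto_sq_div_of_isLittleO_rpow_half hxo).congr' (hmax.mono fun n hn => by simp only [hn]))
  refine ⟨ε, η, hε, hη, ?_⟩
  filter_upwards [h, hmax, hr] with n h1 h2 h3
  rw [h2] at h1
  rw [h3, h1]

theorem tendsto_one_iff_of_eventually_eq {r x : ℕ → ℝ} (hx : ∀ᶠ n in atTop, 0 ≤ x n)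
    (hr : ∀ᶠ n in atTop, r n = normalTailRatio n (x n)) :
    Tendsto r atTop (𝓝 1) ↔ x =o[atTop] (fun n : ℕ => (n : ℝ) ^ (1 / 4 : ℝ)) := by
  have hmax : ∀ᶠ n in atTop, max (x n) 0 = x n := hx.mono fun n hn => max_eq_left hn
  have h := tendsto_normalTailRatio_iff (x := fun n => max (x n) 0) fun n => le_max_right _ _
  refine Iff.trans (tendsto_congr' ?_) (h.trans (isLittleO_congr hmax EventuallyEq.rfl))
  filter_upwards [hr, hmax] with n h1 h2
  rw [h1, h2]

theorem mainTheorem8 {Ω : Type*} [MeasurableSpace Ω] (P : Measure Ω) [IsProbabilityMeasure P]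
    (σ : ℝ≥0) (hσ : 0 < σ) (X : ℕ → Ω → ℝ)
    (hlaw : ∀ i, HasLaw (X i) (gaussianReal 0 (σ ^ 2)) P) (hindep : iIndepFun X P) :
    (∀ x : ℕ → ℝ, Tendsto x atTop atTop →
      x =o[atTop] (fun n : ℕ => (n : ℝ) ^ (1 / 2 : ℝ)) →
      (∃ ε η : ℕ → ℝ, Tendsto ε atTop (𝓝 0) ∧ Tendsto η atTop (𝓝 0) ∧
        ∀ᶠ n in atTop, upperTailRatio P X n (x n) =
          Real.exp (-(x n ^ 4 / (4 * (n : ℝ))) * (1 + ε n)) * (1 + η n)) ∧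
      (∃ ε η : ℕ → ℝ, Tendsto ε atTop (𝓝 0) ∧ Tendsto η atTop (𝓝 0) ∧
        ∀ᶠ n in atTop, lowerTailRatio P X n (x n) =
          Real.exp (-(x n ^ 4 / (4 * (n : ℝ))) * (1 + ε n)) * (1 + η n))) ∧
    (∀ x : ℕ → ℝ, (∀ᶠ n in atTop, 0 ≤ x n) →
      (Tendsto (fun n => upperTailRatio P X n (x n)) atTop (𝓝 1) ↔
        x =o[atTop] (fun n : ℕ => (n : ℝ) ^ (1 / 4 : ℝ))) ∧
      (Tendsto (fun n => lowerTailRatio P X n (x n)) atTop (𝓝 1) ↔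
        x =o[atTop] (fun n : ℕ => (n : ℝ) ^ (1 / 4 : ℝ)))) := by
  have hupper : ∀ x : ℕ → ℝ, (∀ᶠ n in atTop, 0 ≤ x n) →
      ∀ᶠ n in atTop, upperTailRatio P X n (x n) = normalTailRatio n (x n) := fun x hx => by
    filter_upwards [hx, eventually_gt_atTop 0] with n hxn hn
    exact upperTailRatio_eq hσ hlaw hindep hn hxn
  have hlower : ∀ x : ℕ → ℝ, (∀ᶠ n in atTop, 0 ≤ x n) →
      ∀ᶠ n in atTop, lowerTailRatio P X n (x n) = normalTailRatio n (x n) := fun x hx => by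
    filter_upwards [hx, eventually_gt_atTop 0] with n hxn hn
    exact lowerTailRatio_eq hσ hlaw hindep hn hxn
  refine ⟨fun x hx hxo => ?_, fun x hx => ?_⟩
  · have hx0 := hx.eventually_ge_atTop 0
    exact ⟨expansion_of_eventually_eq hx hxo (hupper x hx0),
      expansion_of_eventually_eq hx hxo (hlower x hx0)⟩
  · exact ⟨tendsto_one_iff_of_eventually_eq hx (hupper x hx),
      tendsto_one_iff_of_eventually_eq hx (hlower x hx)⟩
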